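/- Let $\sigma>0$, $D_e\ge 0$ and $\lambda>0$. For each $n\ge 1$ let $u=u^{(n)}\in\{-1,+1\}^n$ be an arbitrary deterministic watermark, and let the covertext $X=(X_1,\dots,X_n)$ have i.i.d. $\mathcal N(0,\sigma^2)$ components. Put $\rho=\frac1n\sum_{i=1}^n X_iu_i$, and let $\mathrm{sgn}(t)=1$ for $t\ge 0$, $\mathrm{sgn}(t)=-1$ for $t<0$. The sign embedder outputs the stegotext $Y=X+\mathrm{sgn}(\rho)\sqrt{D_e}\,u$. The detector compares with the threshold $\lambda$ the Gaussian empirical mutual information $$\hat I_{uy}(U;Y)=-\frac12\ln\left(1-\frac{\left(\frac1n\sum_{i=1}^n u_iy_i\right)^2}{\frac1n\sum_{i=1}^n y_i^2}\right)$$ (equal to $+\infty$ if the ratio is $1$), and declares the watermark absent when $\hat I_{uy}(U;Y)\le\lambda$. Let $P_{fn}^{(n)}=\Pr\{\hat I_{uY}(U;Y)\le\lambda\}$ be its false-negative probability, where $Y$ is the above stegotext. Then the false-negative exponent $$E_{fn}^{se}(\lambda,D_e)=\lim_{n\to\infty}-\frac1n\ln P_{fn}^{(n)}$$ (with $\ln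 0=-\infty$) exists and equals $$E_{fn}^{se}(\lambda,D_e)=\begin{cases}0, & \dfrac{D_ee^{-2\lambda}}{1-e^{-2\lambda}}\le\sigma^2,\\[2mm] \dfrac12\left[q-\ln q-1\right], & \text{otherwise,}\end{cases}\qquad q=\frac{D_ee^{-2\lambda}}{\sigma^2(1-e^{-2\lambda})}.$$ -/

import Mathlib

open MeasureTheory ProbabilityTheory Filter Topology
open scoped ENNReal

noncomputable section

/-- The signum function with the convention `sgn 0 = 1`. -/
def sgn (t : ℝ) : ℝ := if 0 ≤ t then 1 else -1

/-- The empirical correlation `(1/n) ∑ i, a i * b i`. -/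
def empCorr {n : ℕ} (a b : Fin n → ℝ) : ℝ := (1 / (n : ℝ)) * ∑ i, a i * b i

/-- The sign embedder: `y = x + sgn(ρ) √D u`, where `ρ = (1/n) ∑ i, x i * u i`. -/
def signEmbed {n : ℕ} (D : ℝ) (u x : Fin n → ℝ) : Fin n → ℝ :=
  fun i => x i + sgn (empCorr x u) * Real.sqrt D * u i

/-- The (Gaussian) empirical mutual information
`-(1/2) ln (1 - ((1/n) ∑ u i y i)² / ((1/n) ∑ (y i)²))`, with values in `[-∞, ∞]`
because it is `+∞` when `y` is a nonzero multiple of `u`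
(here `ENNReal.log 0 = ⊥`). -/
def empMutualInfo {n : ℕ} (u y : Fin n → ℝ) : EReal :=
  ((-(1 / 2) : ℝ) : EReal) *
    ENNReal.log (ENNReal.ofReal (1 - empCorr u y ^ 2 / empCorr y y))

/-- The law `N(0, σ² I_n)` of the i.i.d. covertext. -/
def covertextLaw (n : ℕ) (σ : ℝ) : Measure (Fin n → ℝ) :=
  Measure.pi fun _ => gaussianReal 0 (Real.toNNReal (σ ^ 2))

/-- The false-negative probability of the sign embedder with watermark `u`: the probability that
the empirical mutual information of `u` and the stegotext does not exceed the threshold `lam`. -/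
def falseNegProb {n : ℕ} (σ D lam : ℝ) (u : Fin n → ℝ) : ℝ≥0∞ :=
  covertextLaw n σ {x | empMutualInfo u (signEmbed D u x) ≤ (lam : EReal)}

/-- `p n` decays with exponent `E`, i.e. `lim -(1/n) ln (p n) = E`, where `ln 0 = -∞`. -/
def HasErrorExponent (p : ℕ → ℝ≥0∞) (E : EReal) : Prop :=
  Tendsto (fun n : ℕ => ((-(1 / (n : ℝ)) : ℝ) : EReal) * ENNReal.log (p n)) atTop (𝓝 E)

end

/-! Let `A` be the empirical power of `x`, `r = |ρ|`, `e = exp (-2λ)`. Since `u` has unit power and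
the embedder aligns signs, a miss means `e (r + √D)² ≤ (1 - e)(A - r²)`. Correlation only hurts a
miss, so the cheapest miss has `r ≈ 0` and `A ≈ M = D e / (1 - e)`: the exponent is the cost of
raising the power of Gaussian noise from `σ²` to `max M σ²`. Both bounds change the variance from
`σ²` to `τ² ≥ σ²`, with a likelihood ratio depending on `A` alone. For `M > σ²`, `falseNegProb_le`
bounds a miss by `A ≥ M` and takes `τ² = M`. In `eventually_exp_le_falseNegProb` the new variance
slightly exceeds `τ² ≥ M`; the law of large numbers makes a miss typical, and the likelihood ratio
gives the rate. -/

/-! ### Change of variance for Gaussian product laws. -/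

open scoped NNReal in
/-- The density of `N(0, s)` with respect to `N(0, v)`. -/
theorem gaussianReal_eq_withDensity_gaussianReal {s v : ℝ≥0} (hs : s ≠ 0) (hv : v ≠ 0) :
    gaussianReal 0 s = (gaussianReal 0 v).withDensity fun x =>
      ENNReal.ofReal (Real.exp (Real.log (v / s) / 2 - x ^ 2 / 2 * (1 / s - 1 / v))) := by
  have hs' : (0 : ℝ) < s := by positivity
  have hv' : (0 : ℝ) < v := by positivity
  rw [gaussianReal_of_var_ne_zero _ hs, gaussianReal_of_var_ne_zero _ hv,
    ← withDensity_mul _ (measurable_gaussianPDF 0 v) (by fun_prop)]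
  congr 1
  ext x
  simp only [gaussianPDF, Pi.mul_apply]
  rw [← ENNReal.ofReal_mul (gaussianPDFReal_nonneg 0 v x)]
  congr 1
  have hlog : Real.exp (Real.log (v / s) / 2) = √v / √s := by
    rw [← Real.sqrt_div hv'.le, Real.sqrt_eq_rpow, Real.rpow_def_of_pos (by positivity)]
    ring_nf
  simp only [gaussianPDFReal, sub_zero]
  rw [Real.exp_sub, hlog, Real.sqrt_mul (by positivity), Real.sqrt_mul (by positivity)]
  have hexp : Real.exp (-x ^ 2 / (2 * s)) =
      Real.exp (-x ^ 2 / (2 * v)) / Real.exp (x ^ 2 / 2 * (1 / s - 1 / v)) := by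
    rw [← Real.exp_sub]
    congr 1
    field_simp
    ring
  rw [hexp]
  have h1 : √(v : ℝ) ≠ 0 := by positivity
  have h2 : √(s : ℝ) ≠ 0 := by positivity
  have h3 : √(2 * Real.pi) ≠ 0 := by positivity
  field_simp
  rw [Real.sqrt_mul (by positivity), Real.sqrt_mul (by positivity)]
  ring

/-- The product of measures with densities has the product density. -/
theorem pi_withDensity_eq {ι Ω : Type*} [Fintype ι] [MeasurableSpace Ω] (μ : Measure Ω)
    [IsProbabilityMeasure μ] (f : Ω → ℝ≥0∞) (hf : Measurable f)
    [SigmaFinite (μ.withDensity f)] :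
    Measure.pi (fun _ : ι => μ.withDensity f) =
      (Measure.pi fun _ : ι => μ).withDensity fun x => ∏ i, f (x i) := by
  refine Measure.pi_eq fun t ht => ?_
  have hrect : MeasurableSet (Set.univ.pi t) := MeasurableSet.univ_pi ht
  rw [withDensity_apply _ hrect, ← lintegral_indicator hrect]
  have key := lintegral_prod_eq_prod_lintegral_of_indepFun (μ := Measure.pi fun _ : ι => μ)
    Finset.univ (fun i (x : ι → Ω) => (t i).indicator f (x i))
    (iIndepFun_pi fun i => (hf.indicator (ht i)).aemeasurable)
    (fun i => (hf.indicator (ht i)).comp (measurable_pi_apply i))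
  have hL : ∀ x : ι → Ω, (Set.univ.pi t).indicator (fun x => ∏ i, f (x i)) x =
      ∏ i, (t i).indicator f (x i) := by
    intro x
    by_cases hx : x ∈ Set.univ.pi t
    · rw [Set.indicator_of_mem hx]
      exact Finset.prod_congr rfl fun i _ =>
        (Set.indicator_of_mem (hx i (Set.mem_univ i)) f).symm
    · rw [Set.indicator_of_notMem hx]
      simp only [Set.mem_pi, Set.mem_univ, true_imp_iff, not_forall] at hx
      obtain ⟨i, hi⟩ := hx
      exact (Finset.prod_eq_zero (Finset.mem_univ i) (Set.indicator_of_notMem hi f)).symm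
  simp_rw [hL]
  rw [key]
  refine Finset.prod_congr rfl fun i _ => ?_
  rw [withDensity_apply _ (ht i), ← lintegral_indicator (ht i)]
  exact (measurePreserving_eval (fun _ : ι => μ) i).lintegral_comp (hf.indicator (ht i))

/-- Change of variance in the law of the covertext. -/
theorem covertextLaw_eq_withDensity (n : ℕ) {σ τ : ℝ} (hσ : 0 < σ) (hτ : 0 < τ) :
    covertextLaw n σ = (covertextLaw n τ).withDensity fun x =>
      ENNReal.ofReal (Real.exp (n * (Real.log (τ ^ 2 / σ ^ 2) / 2)
        - (∑ i, x i * x i) / 2 * (1 / σ ^ 2 - 1 / τ ^ 2))) := by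
  have hs : Real.toNNReal (σ ^ 2) ≠ 0 := by simpa using hσ.ne'
  have hv : Real.toNNReal (τ ^ 2) ≠ 0 := by simpa using hτ.ne'
  have h := gaussianReal_eq_withDensity_gaussianReal hs hv
  rw [Real.coe_toNNReal _ (sq_nonneg σ), Real.coe_toNNReal _ (sq_nonneg τ)] at h
  have hfin : IsProbabilityMeasure ((gaussianReal 0 (Real.toNNReal (τ ^ 2))).withDensity fun x =>
      ENNReal.ofReal (Real.exp (Real.log (τ ^ 2 / σ ^ 2) / 2
        - x ^ 2 / 2 * (1 / σ ^ 2 - 1 / τ ^ 2)))) := by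
    rw [← h]; infer_instance
  unfold covertextLaw
  rw [h, pi_withDensity_eq _ _ (by fun_prop)]
  congr 1
  ext x
  rw [← ENNReal.ofReal_prod_of_nonneg (fun i _ => (Real.exp_pos _).le), ← Real.exp_sum]
  congr 2
  rw [Finset.sum_sub_distrib, ← Finset.sum_mul, Finset.sum_div]
  simp [pow_two]

/-- Chernoff bound: as `σ ≤ τ`, the likelihood ratio decreases with the power, so on `A` it is at
most its value at power `a`. -/
theorem covertextLaw_le (n : ℕ) {σ τ : ℝ} (hσ : 0 < σ) (hστ : σ ≤ τ) {a : ℝ}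
    {A : Set (Fin n → ℝ)} (hA : MeasurableSet A) (h : ∀ x ∈ A, n * a ≤ ∑ i, x i * x i) :
    covertextLaw n σ A ≤ ENNReal.ofReal (Real.exp (n * (Real.log (τ ^ 2 / σ ^ 2) / 2
        - a / 2 * (1 / σ ^ 2 - 1 / τ ^ 2)))) * covertextLaw n τ A := by
  have hc : 0 ≤ 1 / σ ^ 2 - 1 / τ ^ 2 := by
    rw [sub_nonneg]; gcongr
  rw [covertextLaw_eq_withDensity n hσ (hσ.trans_le hστ), withDensity_apply _ hA,
    ← setLIntegral_const]
  refine setLIntegral_mono' hA fun x hx => ENNReal.ofReal_le_ofReal (Real.exp_le_exp.2 ?_)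
  nlinarith [mul_le_mul_of_nonneg_right (h x hx) hc]

theorem le_covertextLaw (n : ℕ) {σ τ : ℝ} (hσ : 0 < σ) (hστ : σ ≤ τ) {a : ℝ}
    {A : Set (Fin n → ℝ)} (hA : MeasurableSet A) (h : ∀ x ∈ A, ∑ i, x i * x i ≤ n * a) :
    ENNReal.ofReal (Real.exp (n * (Real.log (τ ^ 2 / σ ^ 2) / 2
        - a / 2 * (1 / σ ^ 2 - 1 / τ ^ 2)))) * covertextLaw n τ A ≤ covertextLaw n σ A := by
  have hc : 0 ≤ 1 / σ ^ 2 - 1 / τ ^ 2 := by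
    rw [sub_nonneg]; gcongr
  rw [covertextLaw_eq_withDensity n hσ (hσ.trans_le hστ), withDensity_apply _ hA,
    ← setLIntegral_const]
  refine setLIntegral_mono' hA fun x hx => ENNReal.ofReal_le_ofReal (Real.exp_le_exp.2 ?_)
  nlinarith [mul_le_mul_of_nonneg_right (h x hx) hc]

/-- The weak law of large numbers for a coordinatewise sum under a product measure, in Chebyshev's
form. -/
theorem pi_average_deviation_le {n : ℕ} (hn : 0 < n) {ν : Measure ℝ} [IsProbabilityMeasure ν]
    (f : Fin n → ℝ → ℝ) (hf : ∀ i, MemLp (f i) 2 ν) {m C : ℝ}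
    (hm : ∀ i, ∫ t, f i t ∂ν = m) (hC : ∀ i, Var[f i; ν] ≤ C) {δ : ℝ} (hδ : 0 < δ) :
    Measure.pi (fun _ : Fin n => ν) {x | δ ≤ |(1 / (n : ℝ)) * ∑ i, f i (x i) - m|} ≤
      ENNReal.ofReal (C / (δ ^ 2 * n)) := by
  have hn' : (0 : ℝ) < n := by exact_mod_cast hn
  set μ := Measure.pi (fun _ : Fin n => ν)
  set S : (Fin n → ℝ) → ℝ := ∑ i, fun x : Fin n → ℝ => f i (x i)
  have hmem : ∀ i, MemLp (fun x : Fin n → ℝ => f i (x i)) 2 μ := fun i =>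
    (hf i).comp_measurePreserving (measurePreserving_eval (fun _ : Fin n => ν) i)
  have hS : MemLp S 2 μ := memLp_finsetSum' _ fun i _ => hmem i
  have hint : ∀ i, ∫ x, f i (x i) ∂μ = m := fun i => by
    rw [← hm i]
    exact integral_comp_eval (μ := fun _ : Fin n => ν) (hf i).aestronglyMeasurable
  have hmean : ∫ x, S x ∂μ = n * m := by
    simp only [S, Finset.sum_apply]
    rw [integral_finsetSum _ fun i _ => (hmem i).integrable (by norm_num)]
    simp [hint]
  have hvar : Var[S; μ] ≤ n * C := by
    rw [variance_sum_pi (μ := fun _ : Fin n => ν) hf]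
    calc ∑ i, Var[f i; ν] ≤ ∑ _i : Fin n, C := Finset.sum_le_sum fun i _ => hC i
      _ = n * C := by simp
  have hcheb := meas_ge_le_variance_div_sq hS (mul_pos hn' hδ)
  rw [hmean] at hcheb
  refine (measure_mono fun x hx => ?_).trans (hcheb.trans (ENNReal.ofReal_le_ofReal ?_))
  · simp only [Set.mem_ofPred_eq, S, Finset.sum_apply] at hx ⊢
    have : ∑ i, f i (x i) - n * m = n * ((1 / (n : ℝ)) * ∑ i, f i (x i) - m) := by
      field_simp
    rw [this, abs_mul, abs_of_pos hn']
    gcongr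
  · calc Var[S; μ] / (n * δ) ^ 2 ≤ n * C / (n * δ) ^ 2 := by gcongr
      _ = C / (δ ^ 2 * n) := by field_simp


/-! ### The missed-detection event. -/

theorem empMutualInfo_le_iff {n : ℕ} (u y : Fin n → ℝ) (lam : ℝ) :
    empMutualInfo u y ≤ (lam : EReal) ↔
      empCorr u y ^ 2 / empCorr y y ≤ 1 - Real.exp (-2 * lam) := by
  unfold empMutualInfo
  set r := empCorr u y ^ 2 / empCorr y y
  rcases le_or_gt (1 - r) 0 with h | h
  -- Ratio at least `1`: the information is `⊤`, and the right side fails too because `exp (-2λ) >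
  -- 0`.
  · rw [ENNReal.ofReal_of_nonpos h, ENNReal.log_zero, EReal.coe_mul_bot_of_neg (by norm_num)]
    have := Real.exp_pos (-2 * lam)
    simp only [top_le_iff, EReal.coe_ne_top, false_iff, not_le]
    linarith
  · rw [ENNReal.log_ofReal_of_pos h, ← EReal.coe_mul, EReal.coe_le_coe_iff]
    have h2 := Real.le_log_iff_exp_le (x := -2 * lam) h
    constructor
    · intro h1
      have := h2.1 (by linarith)
      linarith
    · intro h1
      have := h2.2 (by linarith)
      linarith

theorem sgn_mul_self (t : ℝ) : sgn t * sgn t = 1 := by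
  unfold sgn; split_ifs <;> norm_num

theorem sgn_mul_eq_abs (t : ℝ) : sgn t * t = |t| := by
  unfold sgn; split_ifs with h
  · rw [abs_of_nonneg h, one_mul]
  · rw [abs_of_neg (not_le.1 h)]; ring

theorem empCorr_self_nonneg {n : ℕ} (x : Fin n → ℝ) : 0 ≤ empCorr x x :=
  mul_nonneg (by positivity) (Finset.sum_nonneg fun i _ => mul_self_nonneg (x i))

theorem empCorr_watermark_self {n : ℕ} (hn : 0 < n) {u : Fin n → ℝ}
    (hu : ∀ i, u i = 1 ∨ u i = -1) : empCorr u u = 1 := by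
  have hn' : (n : ℝ) ≠ 0 := by exact_mod_cast hn.ne'
  have : ∀ i, u i * u i = 1 := fun i => by rcases hu i with h | h <;> rw [h] <;> norm_num
  simp [empCorr, this, hn']

theorem empCorr_add_smul_watermark {n : ℕ} (hn : 0 < n) {u : Fin n → ℝ}
    (hu : ∀ i, u i = 1 ∨ u i = -1) (x : Fin n → ℝ) (a : ℝ) :
    empCorr u (fun i => x i + a * u i) = empCorr x u + a := by
  have h1 := empCorr_watermark_self hn hu
  calc empCorr u (fun i => x i + a * u i) = empCorr x u + a * empCorr u u := by
        have h : ∑ i, u i * (x i + a * u i) = ∑ i, x i * u i + a * ∑ i, u i * u i := by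
          rw [Finset.mul_sum, ← Finset.sum_add_distrib]
          exact Finset.sum_congr rfl fun i _ => by ring
        rw [empCorr, h, empCorr, empCorr]
        ring
    _ = _ := by rw [h1, mul_one]

theorem empCorr_add_smul_watermark_self {n : ℕ} (hn : 0 < n) {u : Fin n → ℝ}
    (hu : ∀ i, u i = 1 ∨ u i = -1) (x : Fin n → ℝ) (a : ℝ) :
    empCorr (fun i => x i + a * u i) (fun i => x i + a * u i) =
      empCorr x x + 2 * (a * empCorr x u) + a ^ 2 := by
  have h1 := empCorr_watermark_self hn hu
  calc _ = empCorr x x + 2 * (a * empCorr x u) + a ^ 2 * empCorr u u := by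
        have h : ∑ i, (x i + a * u i) * (x i + a * u i) =
            ∑ i, x i * x i + 2 * a * ∑ i, x i * u i + a ^ 2 * ∑ i, u i * u i := by
          rw [Finset.mul_sum, Finset.mul_sum, ← Finset.sum_add_distrib, ← Finset.sum_add_distrib]
          exact Finset.sum_congr rfl fun i _ => by ring
        rw [empCorr, h, empCorr, empCorr, empCorr]
        ring
    _ = _ := by rw [h1, mul_one]

/-- A missed detection, in terms of the empirical power of the covertext and its empirical
correlation with the watermark. -/
theorem empMutualInfo_signEmbed_le_iff {n : ℕ} (hn : 0 < n) {u : Fin n → ℝ}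
    (hu : ∀ i, u i = 1 ∨ u i = -1) (x : Fin n → ℝ) {D : ℝ} (hD : 0 ≤ D) (lam : ℝ) :
    empMutualInfo u (signEmbed D u x) ≤ (lam : EReal) ↔
      (|empCorr x u| + √D) ^ 2 / (empCorr x x + 2 * |empCorr x u| * √D + D) ≤
        1 - Real.exp (-2 * lam) := by
  rw [empMutualInfo_le_iff]
  unfold signEmbed
  rw [empCorr_add_smul_watermark hn hu, empCorr_add_smul_watermark_self hn hu]
  set ρ := empCorr x u
  have h1 := sgn_mul_self ρ
  have h2 := sgn_mul_eq_abs ρ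
  have h3 := Real.mul_self_sqrt hD
  have e1 : (ρ + sgn ρ * √D) ^ 2 = (|ρ| + √D) ^ 2 := by
    rw [← h2]
    linear_combination (√D ^ 2 - ρ ^ 2) * h1
  have e2 : empCorr x x + 2 * (sgn ρ * √D * ρ) + (sgn ρ * √D) ^ 2 =
      empCorr x x + 2 * |ρ| * √D + D := by
    rw [← h2]
    linear_combination √D ^ 2 * h1 + h3
  rw [e1, e2]

theorem power_ge_of_missed_detection {n : ℕ} (hn : 0 < n) {u : Fin n → ℝ}
    (hu : ∀ i, u i = 1 ∨ u i = -1) (x : Fin n → ℝ) {D lam : ℝ} (hD : 0 < D) (hlam : 0 < lam)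
    (h : empMutualInfo u (signEmbed D u x) ≤ (lam : EReal)) :
    D * Real.exp (-2 * lam) / (1 - Real.exp (-2 * lam)) ≤ empCorr x x := by
  rw [empMutualInfo_signEmbed_le_iff hn hu x hD.le] at h
  have hc : Real.exp (-2 * lam) < 1 := by
    rw [Real.exp_lt_one_iff]; linarith
  have he := Real.exp_pos (-2 * lam)
  have hA := empCorr_self_nonneg x
  have hs := Real.mul_self_sqrt hD.le
  have hr := abs_nonneg (empCorr x u)
  have hs0 := Real.sqrt_nonneg D
  have hp := mul_nonneg hr hs0
  rw [div_le_iff₀ (by nlinarith)] at h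
  rw [div_le_iff₀ (by linarith)]
  set r := |empCorr x u|
  set e := Real.exp (-2 * lam)
  -- The denominator equals `(A - r²) + (r + √D)²`; discarding the nonnegative terms in `r` then
  -- leaves `e D ≤ (1 - e) A`.
  have h' : e * (r + √D) ^ 2 ≤ (1 - e) * (empCorr x x - r ^ 2) := by nlinarith
  nlinarith [mul_nonneg he.le hp, mul_nonneg he.le (sq_nonneg r),
    mul_nonneg (sub_nonneg.2 hc.le) (sq_nonneg r)]

theorem missed_detection_of_le {n : ℕ} (hn : 0 < n) {u : Fin n → ℝ}
    (hu : ∀ i, u i = 1 ∨ u i = -1) (x : Fin n → ℝ) {D lam : ℝ} (hD : 0 ≤ D) (hlam : 0 < lam)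
    (h : Real.exp (-2 * lam) / (1 - Real.exp (-2 * lam)) * (|empCorr x u| + √D) ^ 2 ≤
      empCorr x x - empCorr x u ^ 2) :
    empMutualInfo u (signEmbed D u x) ≤ (lam : EReal) := by
  rw [empMutualInfo_signEmbed_le_iff hn hu x hD]
  have hc : Real.exp (-2 * lam) < 1 := by
    rw [Real.exp_lt_one_iff]; linarith
  have hA := empCorr_self_nonneg x
  have hs := Real.mul_self_sqrt hD
  rw [div_mul_eq_mul_div, div_le_iff₀ (by linarith), ← sq_abs (empCorr x u)] at h
  -- The denominator may vanish here; the quotient is then `0`.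
  refine div_le_of_le_mul₀ (by positivity) (by linarith) ?_
  nlinarith

/-! ### Typical covertexts. -/

theorem measurable_empCorr_self {n : ℕ} : Measurable fun x : Fin n → ℝ => empCorr x x := by
  unfold empCorr; fun_prop

theorem measurable_empCorr_left {n : ℕ} (u : Fin n → ℝ) :
    Measurable fun x : Fin n → ℝ => empCorr x u := by
  unfold empCorr; fun_prop

instance isProbabilityMeasure_covertextLaw (n : ℕ) (σ : ℝ) :
    IsProbabilityMeasure (covertextLaw n σ) := by
  unfold covertextLaw; infer_instance

/-- With high probability the empirical power of the covertext is close to its variance and its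
empirical correlation with the watermark is small. -/
theorem eventually_half_le_typical {τ δ : ℝ} (hδ : 0 < δ) (u : (n : ℕ) → Fin n → ℝ)
    (hu : ∀ n i, u n i = 1 ∨ u n i = -1) :
    ∀ᶠ n : ℕ in atTop, ENNReal.ofReal (1 / 2) ≤
      covertextLaw n τ {x | |empCorr x x - τ ^ 2| < δ ∧ |empCorr x (u n)| < δ} := by
  set ν := gaussianReal 0 (Real.toNNReal (τ ^ 2))
  have hid : MemLp (fun t : ℝ => t) 2 ν := memLp_id_gaussianReal' 2 (by norm_num)
  -- Hölder with `1/4 + 1/4 = 1/2`, using the finite fourth moment.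
  have hsq : MemLp (fun t : ℝ => t * t) 2 ν :=
    MemLp.mul (p := 4) (q := 4) (memLp_id_gaussianReal' 4 (by norm_num))
      (memLp_id_gaussianReal' 4 (by norm_num)) (hpqr := ⟨by
        rw [show (4 : ℝ≥0∞) = 2 * 2 by norm_num, ENNReal.mul_inv (by simp) (by simp), ← mul_add,
          ENNReal.inv_two_add_inv_two, mul_one]⟩)
  have hmean : ∫ t, t ∂ν = 0 := integral_id_gaussianReal
  have hvar : Var[fun t : ℝ => t; ν] = τ ^ 2 := by
    rw [variance_fun_id_gaussianReal, Real.coe_toNNReal _ (sq_nonneg τ)]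
  have hmean2 : ∫ t, t * t ∂ν = τ ^ 2 := by
    have h := variance_of_integral_eq_zero (μ := ν) (X := fun t : ℝ => t) (by fun_prop) hmean
    rw [hvar] at h
    rw [h]
    simp only [pow_two]
  set C := Var[fun t : ℝ => t * t; ν]
  have hlim : Tendsto (fun n : ℕ => (C + τ ^ 2) / δ ^ 2 / n) atTop (𝓝 0) :=
    tendsto_const_div_atTop_nhds_zero_nat _
  filter_upwards [hlim.eventually_lt_const (show (0 : ℝ) < 1 / 2 by norm_num),
    eventually_gt_atTop 0] with n hnC hn
  have hC0 : 0 ≤ C := variance_nonneg _ _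
  have h1 := pi_average_deviation_le hn (ν := ν) (fun _ t => t * t) (fun _ => hsq)
    (fun _ => hmean2) (fun _ => le_refl C) hδ
  have h2 := pi_average_deviation_le hn (ν := ν) (fun i t => t * u n i)
    (fun i => hid.mul_const _) (m := 0) (fun i => by rw [integral_mul_const, hmean, zero_mul])
    (C := τ ^ 2) (fun i => by
      rw [variance_mul_const, hvar]
      rcases hu n i with h | h <;> rw [h] <;> norm_num) hδ
  set A := {x : Fin n → ℝ | |empCorr x x - τ ^ 2| < δ ∧ |empCorr x (u n)| < δ}
  have hA : MeasurableSet A :=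
    (measurableSet_lt ((measurable_empCorr_self.sub_const _).abs) measurable_const).inter
      (measurableSet_lt ((measurable_empCorr_left (u n)).abs) measurable_const)
  have hcompl : covertextLaw n τ Aᶜ ≤ ENNReal.ofReal (1 / 2) := by
    refine (measure_mono (fun x hx => ?_)).trans ((measure_union_le _ _).trans
      ((add_le_add h1 h2).trans ?_))
    · by_contra hcon
      simp only [Set.mem_union, Set.mem_ofPred_eq, not_or, not_le, sub_zero] at hcon
      exact hx hcon
    · rw [← ENNReal.ofReal_add (by positivity) (by positivity), ← add_div, ← div_div]
      exact ENNReal.ofReal_le_ofReal hnC.le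
  have hsum := prob_add_prob_compl (μ := covertextLaw n τ) hA
  have hone : ENNReal.ofReal (1 / 2) + ENNReal.ofReal (1 / 2) = 1 := by
    rw [← ENNReal.ofReal_add (by norm_num) (by norm_num)]; norm_num
  have h4 : ENNReal.ofReal (1 / 2) + ENNReal.ofReal (1 / 2) ≤
      covertextLaw n τ A + ENNReal.ofReal (1 / 2) := by
    rw [hone, ← hsum]; gcongr
  exact (ENNReal.add_le_add_iff_right ENNReal.ofReal_ne_top).1 h4

/-! ### Exponential bounds and the exponent. -/

theorem hasErrorExponent_of_bounds {p : ℕ → ℝ≥0∞} {E : ℝ}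
    (hle : ∀ᶠ n : ℕ in atTop, p n ≤ ENNReal.ofReal (Real.exp (-(n * E))))
    (hge : ∀ ε > 0, ∀ᶠ n : ℕ in atTop, ENNReal.ofReal (Real.exp (-(n * (E + ε)))) ≤ p n) :
    HasErrorExponent p E := by
  have hval : ∀ (n : ℕ) (F : ℝ), 0 < n → ((-(1 / (n : ℝ)) : ℝ) : EReal) *
      ENNReal.log (ENNReal.ofReal (Real.exp (-(n * F)))) = F := fun n F hn => by
    have hn' : (n : ℝ) ≠ 0 := by exact_mod_cast hn.ne'
    rw [ENNReal.log_ofReal_of_pos (Real.exp_pos _), Real.log_exp, ← EReal.coe_mul]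
    congr 1
    field_simp
  have hanti : ∀ (n : ℕ) {a b : EReal}, a ≤ b → ((-(1 / (n : ℝ)) : ℝ) : EReal) * b ≤
      ((-(1 / (n : ℝ)) : ℝ) : EReal) * a := fun n a b hab => by
    rw [EReal.coe_neg, EReal.neg_mul, EReal.neg_mul, EReal.neg_le_neg_iff]
    exact mul_le_mul_of_nonneg_left hab (by exact_mod_cast (by positivity : (0 : ℝ) ≤ 1 / n))
  refine tendsto_order.2 ⟨fun a ha => ?_, fun b hb => ?_⟩
  · filter_upwards [hle, eventually_gt_atTop 0] with n h hn
    rw [← hval n E hn] at ha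
    exact ha.trans_le (hanti n (ENNReal.log_le_log h))
  · obtain ⟨F, hF, hFb⟩ := EReal.lt_iff_exists_real_btwn.1 hb
    have hEF : E < F := EReal.coe_lt_coe_iff.1 hF
    filter_upwards [hge (F - E) (sub_pos.2 hEF), eventually_gt_atTop 0] with n h hn
    rw [add_sub_cancel] at h
    rw [← hval n F hn] at hFb
    exact (hanti n (ENNReal.log_le_log h)).trans_lt hFb

theorem falseNegProb_le {n : ℕ} (hn : 0 < n) {σ D lam τ : ℝ} (hσ : 0 < σ) (hστ : σ ≤ τ)
    (hD : 0 < D) (hlam : 0 < lam)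
    (hτ : τ ^ 2 = D * Real.exp (-2 * lam) / (1 - Real.exp (-2 * lam)))
    {u : Fin n → ℝ} (hu : ∀ i, u i = 1 ∨ u i = -1) :
    falseNegProb σ D lam u ≤ ENNReal.ofReal (Real.exp (-(n * (1 / 2 *
      (τ ^ 2 / σ ^ 2 - Real.log (τ ^ 2 / σ ^ 2) - 1))))) := by
  have hn' : (0 : ℝ) < n := by exact_mod_cast hn
  have hτ0 := hσ.trans_le hστ
  refine (measure_mono (t := {x | τ ^ 2 ≤ empCorr x x}) fun x hx => ?_).trans
    ((covertextLaw_le n hσ hστ (a := τ ^ 2)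
      (measurableSet_le measurable_const measurable_empCorr_self) fun x hx => ?_).trans
      ((mul_le_of_le_one_right' prob_le_one).trans (ENNReal.ofReal_le_ofReal
        (Real.exp_le_exp.2 (le_of_eq ?_)))))
  · rw [Set.mem_ofPred_eq, hτ]
    exact power_ge_of_missed_detection hn hu x hD hlam hx
  · have hx' : τ ^ 2 ≤ 1 / (n : ℝ) * ∑ i, x i * x i := hx
    rw [one_div_mul_eq_div, le_div_iff₀ hn'] at hx'
    linarith
  -- With the level `a` equal to the tilted variance `τ²`, the Chernoff exponent is exactly the
  -- claimed rate.
  · field_simp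
    ring

/-- Hypothesis `h` is the miss condition at the worst corner of the `δ`-typical set, and `hF`
compares `F` with the smallest likelihood ratio there. The strict inequality absorbs the factor
`1/2` from the typical probability. -/
theorem eventually_le_falseNegProb {σ D lam τ δ : ℝ} (hσ : 0 < σ) (hστ : σ ≤ τ)
    (hD : 0 ≤ D) (hlam : 0 < lam) (hδ : 0 < δ)
    (h : Real.exp (-2 * lam) / (1 - Real.exp (-2 * lam)) * (δ + √D) ^ 2 ≤ τ ^ 2 - δ - δ ^ 2)
    (u : (n : ℕ) → Fin n → ℝ) (hu : ∀ n i, u n i = 1 ∨ u n i = -1) {F : ℝ}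
    (hF : -F < Real.log (τ ^ 2 / σ ^ 2) / 2 - (τ ^ 2 + δ) / 2 * (1 / σ ^ 2 - 1 / τ ^ 2)) :
    ∀ᶠ n : ℕ in atTop,
      ENNReal.ofReal (Real.exp (-(n * F))) ≤ falseNegProb σ D lam (u n) := by
  have hc : Real.exp (-2 * lam) < 1 := by
    rw [Real.exp_lt_one_iff]; linarith
  set g := Real.log (τ ^ 2 / σ ^ 2) / 2 - (τ ^ 2 + δ) / 2 * (1 / σ ^ 2 - 1 / τ ^ 2)
  have hlim : Tendsto (fun n : ℕ => (n : ℝ) * (g + F)) atTop atTop :=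
    tendsto_natCast_atTop_atTop.atTop_mul_const (by linarith)
  filter_upwards [eventually_half_le_typical (τ := τ) hδ u hu, eventually_gt_atTop 0,
    hlim.eventually_ge_atTop (Real.log 2)] with n hhalf hn hnlarge
  have hn' : (0 : ℝ) < n := by exact_mod_cast hn
  set A := {x : Fin n → ℝ | |empCorr x x - τ ^ 2| < δ ∧ |empCorr x (u n)| < δ}
  have hA : MeasurableSet A :=
    (measurableSet_lt ((measurable_empCorr_self.sub_const _).abs) measurable_const).inter
      (measurableSet_lt ((measurable_empCorr_left (u n)).abs) measurable_const)
  have hsub : A ⊆ {x | empMutualInfo (u n) (signEmbed D (u n) x) ≤ (lam : EReal)} := by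
    rintro x ⟨hx1, hx2⟩
    refine missed_detection_of_le hn (hu n) x hD hlam (le_trans ?_ (h.trans ?_))
    · have : 0 ≤ Real.exp (-2 * lam) / (1 - Real.exp (-2 * lam)) :=
        div_nonneg (Real.exp_pos _).le (by linarith)
      gcongr
    · have h1 := (abs_lt.1 hx1).1
      have h2 : empCorr x (u n) ^ 2 ≤ δ ^ 2 := sq_le_sq' (abs_lt.1 hx2).1.le (abs_lt.1 hx2).2.le
      linarith
  have hmain := le_covertextLaw n hσ hστ (a := τ ^ 2 + δ) hA fun x hx => by
    have h1 := (abs_lt.1 hx.1).2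
    have h2 : 1 / (n : ℝ) * ∑ i, x i * x i ≤ τ ^ 2 + δ := by
      change empCorr x x ≤ _
      linarith
    rw [one_div_mul_eq_div, div_le_iff₀ hn'] at h2
    linarith
  refine le_trans ?_ (hmain.trans (measure_mono hsub))
  refine le_trans ?_ (mul_le_mul_right hhalf _)
  rw [← ENNReal.ofReal_mul (Real.exp_pos _).le]
  refine ENNReal.ofReal_le_ofReal ?_
  have h2 : Real.exp (-(n * F)) * 2 ≤ Real.exp (n * g) := by
    calc Real.exp (-(n * F)) * 2 = Real.exp (-(n * F) + Real.log 2) := by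
          rw [Real.exp_add, Real.exp_log (by norm_num)]
      _ ≤ Real.exp (n * g) := Real.exp_le_exp.2 (by linarith)
  linarith

/-- Requiring only `M ≤ τ²` serves both regimes: `τ = σ` gives rate `0`, and `τ = √M` gives the
positive rate. -/
theorem eventually_exp_le_falseNegProb {σ D lam τ : ℝ} (hσ : 0 < σ) (hστ : σ ≤ τ)
    (hD : 0 ≤ D) (hlam : 0 < lam)
    (hτ : D * Real.exp (-2 * lam) / (1 - Real.exp (-2 * lam)) ≤ τ ^ 2)
    (u : (n : ℕ) → Fin n → ℝ) (hu : ∀ n i, u n i = 1 ∨ u n i = -1) {ε : ℝ} (hε : 0 < ε) :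
    ∀ᶠ n : ℕ in atTop, ENNReal.ofReal (Real.exp (-(n * (1 / 2 *
      (τ ^ 2 / σ ^ 2 - Real.log (τ ^ 2 / σ ^ 2) - 1) + ε)))) ≤ falseNegProb σ D lam (u n) := by
  have hτ0 := hσ.trans_le hστ
  set F := 1 / 2 * (τ ^ 2 / σ ^ 2 - Real.log (τ ^ 2 / σ ^ 2) - 1) + ε with hF
  set k := Real.exp (-2 * lam) / (1 - Real.exp (-2 * lam)) with hk
  have hkD : k * √D ^ 2 ≤ τ ^ 2 := by
    rw [Real.sq_sqrt hD, hk, div_mul_eq_mul_div, mul_comm]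
    exact hτ
  -- The miss condition may be an equality at `τ`. Enlarging `τ` makes it strict, leaving room for
  -- `δ`; by continuity the rate changes by less than `ε`.
  obtain ⟨τ', hτ', hrate⟩ : ∃ τ' > τ, -F < Real.log (τ' ^ 2 / σ ^ 2) / 2
      - τ' ^ 2 / 2 * (1 / σ ^ 2 - 1 / τ' ^ 2) := by
    have hcont : ContinuousAt (fun t : ℝ => Real.log (t ^ 2 / σ ^ 2) / 2
        - t ^ 2 / 2 * (1 / σ ^ 2 - 1 / t ^ 2)) τ := by
      have h1 : τ ^ 2 / σ ^ 2 ≠ 0 := by positivity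
      have h2 : τ ^ 2 ≠ 0 := by positivity
      fun_prop (disch := assumption)
    have hlt : -F < Real.log (τ ^ 2 / σ ^ 2) / 2 - τ ^ 2 / 2 * (1 / σ ^ 2 - 1 / τ ^ 2) := by
      have : τ ^ 2 / 2 * (1 / σ ^ 2 - 1 / τ ^ 2) = 1 / 2 * (τ ^ 2 / σ ^ 2 - 1) := by
        field_simp
      rw [this, hF]
      linarith
    have hev := (hcont.tendsto.eventually_const_lt hlt).filter_mono
      (nhdsWithin_le_nhds (s := Set.Ioi τ))
    obtain ⟨t, ht1, ht2⟩ := (hev.and (self_mem_nhdsWithin (s := Set.Ioi τ))).exists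
    exact ⟨t, ht2, ht1⟩
  have hτ'sq : τ ^ 2 < τ' ^ 2 := by gcongr
  obtain ⟨δ, hδ, hineq, hrate'⟩ : ∃ δ > 0, k * (δ + √D) ^ 2 < τ' ^ 2 - δ - δ ^ 2 ∧
      -F < Real.log (τ' ^ 2 / σ ^ 2) / 2 - (τ' ^ 2 + δ) / 2 * (1 / σ ^ 2 - 1 / τ' ^ 2) := by
    have hc1 : Continuous fun d : ℝ => k * (d + √D) ^ 2 := by fun_prop
    have hc2 : Continuous fun d : ℝ => τ' ^ 2 - d - d ^ 2 := by fun_prop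
    have hc3 : Continuous fun d : ℝ => Real.log (τ' ^ 2 / σ ^ 2) / 2
        - (τ' ^ 2 + d) / 2 * (1 / σ ^ 2 - 1 / τ' ^ 2) := by fun_prop
    have e1 := hc1.continuousAt.eventually_lt (hc2.continuousAt (x := 0))
      (by simpa using hkD.trans_lt hτ'sq)
    have e2 := (hc3.tendsto 0).eventually_const_lt (u := -F) (by rwa [add_zero])
    have hev := (e1.and e2).filter_mono (nhdsWithin_le_nhds (s := Set.Ioi 0))
    obtain ⟨d, hd1, hd2⟩ := (hev.and (self_mem_nhdsWithin (s := Set.Ioi (0 : ℝ)))).exists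
    exact ⟨d, hd2, hd1⟩
  exact eventually_le_falseNegProb hσ (hστ.trans hτ'.le) hD hlam hδ hineq.le u hu hrate'

theorem theorem3 (σ D lam : ℝ) (hσ : 0 < σ) (hD : 0 ≤ D) (hlam : 0 < lam)
    (u : (n : ℕ) → Fin n → ℝ) (hu : ∀ n i, u n i = 1 ∨ u n i = -1) :
    HasErrorExponent (fun n => falseNegProb σ D lam (u n))
      (((if D * Real.exp (-2 * lam) / (1 - Real.exp (-2 * lam)) ≤ σ ^ 2 then 0
        else (1 / 2) *
          (D * Real.exp (-2 * lam) / (σ ^ 2 * (1 - Real.exp (-2 * lam)))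
            - Real.log (D * Real.exp (-2 * lam) / (σ ^ 2 * (1 - Real.exp (-2 * lam))))
            - 1)) : ℝ) : EReal) := by
  split_ifs with hq
  · refine hasErrorExponent_of_bounds (Eventually.of_forall fun n => ?_) fun ε hε => ?_
    · have h : falseNegProb σ D lam (u n) ≤ 1 := prob_le_one
      simpa using h
    · have h := eventually_exp_le_falseNegProb hσ le_rfl hD hlam hq u hu hε
      have hσ2 : σ ^ 2 / σ ^ 2 = 1 := div_self (by positivity)
      rw [hσ2, Real.log_one, sub_zero, sub_self, mul_zero] at h
      exact h
  · rw [not_le] at hq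
    set M := D * Real.exp (-2 * lam) / (1 - Real.exp (-2 * lam)) with hM
    have hM0 : 0 < M := (by positivity : 0 < σ ^ 2).trans hq
    have hD0 : 0 < D := hD.lt_of_ne fun h => by simp [hM, ← h] at hM0
    have hτ : √M ^ 2 = M := Real.sq_sqrt hM0.le
    have hστ : σ ≤ √M := Real.le_sqrt_of_sq_le hq.le
    have hdiv : D * Real.exp (-2 * lam) / (σ ^ 2 * (1 - Real.exp (-2 * lam))) =
        √M ^ 2 / σ ^ 2 := by
      rw [hτ, hM, div_div, mul_comm (σ ^ 2)]
    rw [hdiv]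
    refine hasErrorExponent_of_bounds ?_ fun ε hε =>
      eventually_exp_le_falseNegProb hσ hστ hD hlam (hM ▸ hτ.ge) u hu hε
    filter_upwards [eventually_gt_atTop 0] with n hn
    exact falseNegProb_le hn hσ hστ hD0 hlam (hτ.trans hM) (hu n)
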